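/- **Conventions.** Let $\Lambda$ be the real Banach algebra of supernumbers $z=\sum_I z_I\zeta^I$, where $\zeta^1,\zeta^2,\dots$ are countably many anticommuting generators, $I$ runs over the finite increasing multi-indices, $z_I\in\mathbb R$, and $\|z\|=\sum_I|z_I|<\infty$. Write $\Lambda^0,\Lambda^1$ for the even and odd parts, $\beta(z)=z_\emptyset\in\mathbb R$ for the body and $s(z)=z-\beta(z)$ for the soul. Let $M$ be a $G^\infty$ supermanifold of dimension $(m,n)$, modelled on $\mathbb R^{m|n}=(\Lambda^0)^m\times(\Lambda^1)^n$; a map is $G^\infty$ if it is $C^\infty$ with $\Lambda^0$-linear derivative. The tangent space $T_qM$ is the $\mathbb Z_2$-graded $\Lambda$-module of superderivations, at $q$, of germs of $G^\infty$ functions. A super Riemannian metric $g$ on $M$ is a $G^\infty$ family of even, biadditive, left $\Lambda$-linear (in the first argument), supersymmetric ($g(X,Y)=(-1)^{|X||Y|}g(Y,X)$), nondegenerate maps $g_q:T_qM\times T_qM\to\Lambda$. A pure basis of $T_qM$ is a $\Lambda$-basis consisting of even vectors $e_1,\dots,e_m$ and odd vectors $f_\alpha$; a pure frame on an open set is a family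 of super vector fields that is a pure basis at each point. Let $\mathcal J$ be the standard symplectic matrix, block diagonal with $l$ blocks $J=\begin{pmatrix}0&1\\-1&0\end{pmatrix}$. **Theorem.** Let $g$ be a super Riemannian metric on $M$, let $p\in M$, and let $\{\bar e_i,\bar f_\alpha\}$ be a pure frame on an open neighbourhood $U$ of $p$ relative to which the matrix of $g$ at each point of $U$ is $$\begin{pmatrix}\operatorname{diag}(d_1,\dots,d_m)&0\\0&\mathcal J\end{pmatrix},\qquad d_i=g(\bar e_i,\bar e_i)\ \text{ invertible in }\Lambda^0 .$$ 1. Suppose that $\dfrac{\|s(d_i)\|}{|\beta(d_i)|}<1$ at $p$ for every $i$. Then there are an open set $V$ with $p\in V\subseteq U$, on which these inequalities still hold, and $G^\infty$ functions $\lambda_i:V\to\Lambda^0$, given by the convergent series $$\lambda_i=\frac1{\sqrt{|\beta(d_i)|}}\sum_{k\ge0}\binom{-1/2}{k}\Big(\frac{s(d_i)}{\beta(d_i)}\Big)^k ,$$ such that, with $\hat e_i=\lambda_i\bar e_i$, the family $\{\hat e_i,\bar f_\alpha\}$ is a pure frame on $V$ relative to which the matrix of $g$ at every point of $V$ is $$\Gamma_g=\begin{pmatrix}\eta&0\\0&\mathcal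 J\end{pmatrix},\qquad \eta=\operatorname{diag}(\pm1,\dots,\pm1),$$ with signs that are constant on $V$; that is, $\Gamma_g$ is a generalized orthosymplectic matrix. 2. Whether or not the condition in (1) holds, there are real numbers $c_i>0$ such that $\tilde e_i=c_i\,\bar e_i(p)$, together with the $\bar f_\alpha(p)$, form a pure basis of $T_pM$ relative to which $g_p$ has the matrix $\begin{pmatrix}\operatorname{diag}(\tilde d_i)&0\\0&\mathcal J\end{pmatrix}$ with $\|\tilde d_i\|=1$ for all $i$; and, for each $i$, $\|s(d_i(p))\|/|\beta(d_i(p))|<1$ if and only if $\|s(\tilde d_i)\|<\frac12$. 3. For every pure basis $\{\tilde e_i,\tilde f_\alpha\}$ of $T_pM$ such that $\tilde d_i=g(\tilde e_i,\tilde e_i)$ satisfies $\|\tilde d_i\|=1$ for all $i$, and for each $i$: $\beta(\tilde d_i)\ne0$ and $\|s(\tilde d_i)\|/|\beta(\tilde d_i)|<1$ if and only if $\|s(\tilde d_i)\|<\frac12$. -/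

import Mathlib

open Filter Topology Set
open scoped ContDiff Manifold

noncomputable section

/-- The Banach space `ℓ₁` of absolutely summable families of real numbers indexed by the increasing
multi-indices, i.e. by the finite subsets `I` of `ℕ`: the family `z` stands for the series
`∑ z_I ζ^I` in the anticommuting generators `ζ^0, ζ^1, …`, and `‖z‖ = ∑ |z_I|`. -/
def Supernumber : Type := lp (fun _ : Finset ℕ => ℝ) 1

namespace Supernumber

instance : NormedAddCommGroup Supernumber :=
  inferInstanceAs (NormedAddCommGroup (lp (fun _ : Finset ℕ => ℝ) 1))

instance : NormedSpace ℝ Supernumber :=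
  inferInstanceAs (NormedSpace ℝ (lp (fun _ : Finset ℕ => ℝ) 1))

instance : CompleteSpace Supernumber :=
  inferInstanceAs (CompleteSpace (lp (fun _ : Finset ℕ => ℝ) 1))

/-- The coefficient `z_I`. -/
def coeff (z : Supernumber) (I : Finset ℕ) : ℝ := Subtype.val z I

@[ext] theorem ext {a b : Supernumber} (h : ∀ I, a.coeff I = b.coeff I) : a = b :=
  Subtype.ext (funext h)

@[simp] theorem coeff_add (a b : Supernumber) (I : Finset ℕ) :
    (a + b).coeff I = a.coeff I + b.coeff I := rfl

@[simp] theorem coeff_zero (I : Finset ℕ) : (0 : Supernumber).coeff I = 0 := rfl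

@[simp] theorem coeff_neg (a : Supernumber) (I : Finset ℕ) : (-a).coeff I = -a.coeff I := rfl

@[simp] theorem coeff_sub (a b : Supernumber) (I : Finset ℕ) :
    (a - b).coeff I = a.coeff I - b.coeff I := rfl

@[simp] theorem coeff_smul (r : ℝ) (a : Supernumber) (I : Finset ℕ) :
    (r • a).coeff I = r * a.coeff I := rfl

theorem summable_abs_coeff (a : Supernumber) : Summable fun I => |a.coeff I| := by
  have h := (memℓp_gen_iff (E := fun _ : Finset ℕ => ℝ) (p := 1) (by simp)).1 (Subtype.property a)
  simp only [ENNReal.toReal_one, Real.rpow_one] at h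
  exact h

theorem norm_eq (a : Supernumber) : ‖a‖ = ∑' I, |a.coeff I| := by
  have h := lp.norm_eq_tsum_rpow (E := fun _ : Finset ℕ => ℝ) (p := 1) (by simp) a
  simp only [ENNReal.toReal_one, Real.rpow_one, div_one] at h
  exact h

/-- The supernumber with a given absolutely summable family of coefficients. -/
def ofCoeff (f : Finset ℕ → ℝ) (hf : Summable fun I => |f I|) : Supernumber :=
  (⟨f, (memℓp_gen_iff (E := fun _ : Finset ℕ => ℝ) (p := 1) (by simp)).2 (by simpa using hf)⟩ :
    lp (fun _ : Finset ℕ => ℝ) 1)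

@[simp] theorem coeff_ofCoeff (f : Finset ℕ → ℝ) (hf : Summable fun I => |f I|) (I : Finset ℕ) :
    (ofCoeff f hf).coeff I = f I := rfl

/-- The sign with `ζ^I ζ^J = sign I J • ζ^(I ∪ J)` for disjoint `I`, `J`:
minus one to the number of pairs in `I × J` that are out of order. -/
def sign (I J : Finset ℕ) : ℝ := (-1) ^ ((I ×ˢ J).filter fun x => x.2 < x.1).card

theorem abs_sign (I J : Finset ℕ) : |sign I J| = 1 := by
  simp [sign, abs_pow]

theorem sign_empty_left (J : Finset ℕ) : sign ∅ J = 1 := by simp [sign]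

theorem sign_empty_right (J : Finset ℕ) : sign J ∅ = 1 := by simp [sign]

theorem sign_union_left {I J : Finset ℕ} (h : Disjoint I J) (K : Finset ℕ) :
    sign (I ∪ J) K = sign I K * sign J K := by
  rw [sign, sign, sign, ← pow_add, Finset.union_product, Finset.filter_union,
    Finset.card_union_of_disjoint]
  exact Finset.disjoint_filter_filter (Finset.disjoint_product.2 (Or.inl h))

theorem sign_union_right (I : Finset ℕ) {J K : Finset ℕ} (h : Disjoint J K) :
    sign I (J ∪ K) = sign I J * sign I K := by
  rw [sign, sign, sign, ← pow_add, Finset.product_union, Finset.filter_union,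
    Finset.card_union_of_disjoint]
  exact Finset.disjoint_filter_filter (Finset.disjoint_product.2 (Or.inr h))

theorem summable_pairs (a b : Supernumber) :
    Summable fun x : (K : Finset ℕ) × {I // I ∈ K.powerset} =>
      |a.coeff x.2.1| * |b.coeff (x.1 \ x.2.1)| := by
  have h : Summable fun y : Finset ℕ × Finset ℕ => |a.coeff y.1| * |b.coeff y.2| :=
    a.summable_abs_coeff.mul_of_nonneg b.summable_abs_coeff
      (fun _ => abs_nonneg _) (fun _ => abs_nonneg _)
  refine h.comp_injective (i := fun x : (K : Finset ℕ) × {I // I ∈ K.powerset} =>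
    ((x.2.1, x.1 \ x.2.1) : Finset ℕ × Finset ℕ)) ?_
  rintro ⟨K, I, hI⟩ ⟨K', I', hI'⟩ hx
  simp only [Prod.mk.injEq] at hx
  obtain ⟨rfl, h2⟩ := hx
  have : K = K' := by
    rw [← Finset.union_sdiff_of_subset (Finset.mem_powerset.1 hI), h2,
      Finset.union_sdiff_of_subset (Finset.mem_powerset.1 hI')]
  subst this
  rfl

theorem tsum_pairs_le (a b : Supernumber) :
    ∑' x : (K : Finset ℕ) × {I // I ∈ K.powerset},
      |a.coeff x.2.1| * |b.coeff (x.1 \ x.2.1)| ≤ ‖a‖ * ‖b‖ := by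
  have h : Summable fun y : Finset ℕ × Finset ℕ => |a.coeff y.1| * |b.coeff y.2| :=
    a.summable_abs_coeff.mul_of_nonneg b.summable_abs_coeff
      (fun _ => abs_nonneg _) (fun _ => abs_nonneg _)
  rw [norm_eq, norm_eq, a.summable_abs_coeff.tsum_mul_tsum b.summable_abs_coeff h]
  refine (summable_pairs a b).tsum_le_tsum_of_inj
    (fun x : (K : Finset ℕ) × {I // I ∈ K.powerset} =>
      ((x.2.1, x.1 \ x.2.1) : Finset ℕ × Finset ℕ)) ?_ (fun _ _ => by positivity)
    (fun _ => le_rfl) h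
  rintro ⟨K, I, hI⟩ ⟨K', I', hI'⟩ hx
  simp only [Prod.mk.injEq] at hx
  obtain ⟨rfl, h2⟩ := hx
  have : K = K' := by
    rw [← Finset.union_sdiff_of_subset (Finset.mem_powerset.1 hI), h2,
      Finset.union_sdiff_of_subset (Finset.mem_powerset.1 hI')]
  subst this
  rfl

/-- The coefficients of the product `a b`. -/
def mulCoeff (a b : Supernumber) (K : Finset ℕ) : ℝ :=
  ∑ I ∈ K.powerset, sign I (K \ I) * (a.coeff I * b.coeff (K \ I))

theorem abs_mulCoeff_le (a b : Supernumber) (K : Finset ℕ) :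
    |mulCoeff a b K| ≤ ∑' I : {I // I ∈ K.powerset}, |a.coeff I.1| * |b.coeff (K \ I.1)| := by
  rw [tsum_fintype, Finset.sum_coe_sort K.powerset fun I => |a.coeff I| * |b.coeff (K \ I)|]
  refine (Finset.abs_sum_le_sum_abs _ _).trans (Finset.sum_le_sum fun I _ => ?_)
  rw [abs_mul, abs_sign, one_mul, abs_mul]

theorem summable_mulCoeff (a b : Supernumber) : Summable fun K => |mulCoeff a b K| :=
  Summable.of_nonneg_of_le (fun _ => abs_nonneg _) (abs_mulCoeff_le a b)
    (summable_pairs a b).sigma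

/-- The product `(∑ a_I ζ^I) (∑ b_J ζ^J)`. -/
instance : Mul Supernumber := ⟨fun a b => ofCoeff (mulCoeff a b) (summable_mulCoeff a b)⟩

theorem coeff_mul (a b : Supernumber) (K : Finset ℕ) :
    (a * b).coeff K = ∑ I ∈ K.powerset, sign I (K \ I) * (a.coeff I * b.coeff (K \ I)) := rfl

theorem norm_mul_le' (a b : Supernumber) : ‖a * b‖ ≤ ‖a‖ * ‖b‖ := by
  refine le_trans ?_ (tsum_pairs_le a b)
  rw [norm_eq, (summable_pairs a b).tsum_sigma]
  exact (summable_mulCoeff a b).tsum_le_tsum (abs_mulCoeff_le a b) (summable_pairs a b).sigma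

instance : One Supernumber :=
  ⟨ofCoeff (fun I => if I = ∅ then 1 else 0)
    (summable_of_ne_finset_zero (s := {∅}) fun I hI => by simp_all)⟩

theorem coeff_one (I : Finset ℕ) : (1 : Supernumber).coeff I = if I = ∅ then 1 else 0 := rfl

protected theorem one_mul (a : Supernumber) : 1 * a = a := by
  ext K
  rw [coeff_mul, Finset.sum_eq_single ∅]
  · simp [coeff_one, sign_empty_left]
  · intro I _ hI; simp [coeff_one, hI]
  · simp

protected theorem mul_one (a : Supernumber) : a * 1 = a := by
  ext K
  rw [coeff_mul, Finset.sum_eq_single K]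
  · simp [coeff_one, sign_empty_right]
  · intro I hI hne
    have : K \ I ≠ ∅ := fun h =>
      hne ((Finset.mem_powerset.1 hI).antisymm (Finset.sdiff_eq_empty_iff_subset.1 h))
    simp [coeff_one, this]
  · simp

protected theorem mul_assoc (a b c : Supernumber) : a * b * c = a * (b * c) := by
  ext K
  simp only [coeff_mul, Finset.mul_sum, Finset.sum_mul]
  rw [Finset.sum_sigma', Finset.sum_sigma']
  refine Finset.sum_bij' (fun x _ => ⟨x.2, x.1 \ x.2⟩) (fun y _ => ⟨y.1 ∪ y.2, y.1⟩) ?_ ?_ ?_ ?_ ?_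
  · rintro ⟨L, I⟩ h
    simp only [Finset.mem_sigma, Finset.mem_powerset] at h ⊢
    exact ⟨h.2.trans h.1, Finset.sdiff_subset_sdiff h.1 le_rfl⟩
  · rintro ⟨I, J⟩ h
    simp only [Finset.mem_sigma, Finset.mem_powerset] at h ⊢
    exact ⟨Finset.union_subset h.1 (h.2.trans Finset.sdiff_subset), Finset.subset_union_left⟩
  · rintro ⟨L, I⟩ h
    simp only [Finset.mem_sigma, Finset.mem_powerset] at h
    simp [Finset.union_sdiff_of_subset h.2]
  · rintro ⟨I, J⟩ h
    simp only [Finset.mem_sigma, Finset.mem_powerset] at h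
    have hd : Disjoint J I := Finset.disjoint_of_subset_left h.2 Finset.sdiff_disjoint
    simp [Finset.union_sdiff_left, Finset.sdiff_eq_self_of_disjoint hd]
  · rintro ⟨L, I⟩ h
    simp only [Finset.mem_sigma, Finset.mem_powerset] at h
    obtain ⟨hL, hI⟩ := h
    have e1 : (K \ I) \ (L \ I) = K \ L := by
      ext x; simp only [Finset.mem_sdiff]; have := @hI x; tauto
    have e2 : K \ I = (L \ I) ∪ (K \ L) := by
      ext x; simp only [Finset.mem_sdiff, Finset.mem_union]
      have := @hI x; have := @hL x; tauto
    have d2 : Disjoint (L \ I) (K \ L) :=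
      Finset.disjoint_of_subset_left Finset.sdiff_subset Finset.disjoint_sdiff
    have s1 : sign L (K \ L) = sign I (K \ L) * sign (L \ I) (K \ L) := by
      have h := sign_union_left (Finset.disjoint_sdiff (s := I) (t := L)) (K \ L)
      rwa [Finset.union_sdiff_of_subset hI] at h
    have s2 : sign I (K \ I) = sign I (L \ I) * sign I (K \ L) := by
      rw [e2]; exact sign_union_right _ d2
    simp only [e1, s1, s2]
    ring

instance : Ring Supernumber :=
  { (inferInstance : AddCommGroup Supernumber) with
    mul := (· * ·)
    one := 1
    mul_assoc := Supernumber.mul_assoc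
    one_mul := Supernumber.one_mul
    mul_one := Supernumber.mul_one
    zero_mul := fun a => by ext K; simp [coeff_mul]
    mul_zero := fun a => by ext K; simp [coeff_mul]
    left_distrib := fun a b c => by
      ext K; simp [coeff_mul, mul_add, Finset.sum_add_distrib]
    right_distrib := fun a b c => by
      ext K; simp [coeff_mul, add_mul, mul_add, Finset.sum_add_distrib] }

instance : NormedRing Supernumber :=
  { (inferInstance : NormedAddCommGroup Supernumber), (inferInstance : Ring Supernumber) with
    norm_mul_le := norm_mul_le' }

instance : Algebra ℝ Supernumber :=
  Algebra.ofModule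
    (fun r a b => by
      ext K; simp only [coeff_mul, coeff_smul, Finset.mul_sum]
      exact Finset.sum_congr rfl fun _ _ => by ring)
    (fun r a b => by
      ext K; simp only [coeff_mul, coeff_smul, Finset.mul_sum]
      exact Finset.sum_congr rfl fun _ _ => by ring)

instance : NormedAlgebra ℝ Supernumber :=
  { (inferInstance : Algebra ℝ Supernumber) with norm_smul_le := norm_smul_le }

/-- The body `β(z) = z_∅`. -/
def body (z : Supernumber) : ℝ := z.coeff ∅

/-- The soul `s(z) = z - β(z)`. -/
def soul (z : Supernumber) : Supernumber := z - algebraMap ℝ Supernumber z.body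

/-- `z` is homogeneous of parity `ε`: only the `ζ^I` with `|I| ≡ ε` modulo two occur in `z`. -/
def HasParity (ε : ZMod 2) (z : Supernumber) : Prop := ∀ I, z.coeff I ≠ 0 → (I.card : ZMod 2) = ε

theorem HasParity.mul {ε δ : ZMod 2} {a b : Supernumber} (ha : HasParity ε a)
    (hb : HasParity δ b) : HasParity (ε + δ) (a * b) := by
  intro K hK
  rw [coeff_mul] at hK
  obtain ⟨I, hI, hne⟩ := Finset.exists_ne_zero_of_sum_ne_zero hK
  have h1 := ha I (by intro h; simp [h] at hne)
  have h2 := hb (K \ I) (by intro h; simp [h] at hne)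
  rw [← h1, ← h2, ← Nat.cast_add, add_comm,
    Finset.card_sdiff_add_card_eq_card (Finset.mem_powerset.1 hI)]

theorem HasParity.add {ε : ZMod 2} {a b : Supernumber} (ha : HasParity ε a)
    (hb : HasParity ε b) : HasParity ε (a + b) := by
  intro K hK
  by_cases h : a.coeff K = 0
  · exact hb K (by simpa [h] using hK)
  · exact ha K h

theorem hasParity_zero (ε : ZMod 2) : HasParity ε 0 := fun _ h => absurd rfl h

theorem hasParity_algebraMap (r : ℝ) : HasParity 0 (algebraMap ℝ Supernumber r) := by
  intro K hK
  rw [Algebra.algebraMap_eq_smul_one, coeff_smul, coeff_one] at hK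
  by_cases h : K = ∅
  · simp [h]
  · simp [h] at hK

theorem sign_mul_sign {I J : Finset ℕ} (h : Disjoint I J) :
    sign I J * sign J I = (-1) ^ (I.card * J.card) := by
  have h1 : ((J ×ˢ I).filter fun x => x.2 < x.1).card
      = ((I ×ˢ J).filter fun x => ¬ x.2 < x.1).card := by
    refine Finset.card_bij' (fun x _ => x.swap) (fun x _ => x.swap) ?_ ?_ ?_ ?_
    · rintro ⟨i, j⟩ hx
      simp only [Finset.mem_filter, Finset.mem_product, Prod.swap] at hx ⊢
      exact ⟨⟨hx.1.2, hx.1.1⟩, by omega⟩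
    · rintro ⟨i, j⟩ hx
      simp only [Finset.mem_filter, Finset.mem_product, Prod.swap] at hx ⊢
      have hne : i ≠ j := fun e => Finset.disjoint_left.1 h hx.1.1 (e ▸ hx.1.2)
      exact ⟨⟨hx.1.2, hx.1.1⟩, by omega⟩
    · intro _ _; rfl
    · intro _ _; rfl
  rw [sign, sign, h1, ← pow_add, Finset.card_filter_add_card_filter_not, Finset.card_product]

theorem HasParity.comm {a : Supernumber} (ha : HasParity 0 a) (b : Supernumber) :
    a * b = b * a := by
  ext K
  rw [coeff_mul, coeff_mul]
  refine Finset.sum_bij' (fun I _ => K \ I) (fun I _ => K \ I) ?_ ?_ ?_ ?_ ?_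
  · intro I _; simp
  · intro I _; simp
  · intro I hI; exact Finset.sdiff_sdiff_eq_self (Finset.mem_powerset.1 hI)
  · intro I hI; exact Finset.sdiff_sdiff_eq_self (Finset.mem_powerset.1 hI)
  · intro I hI
    rw [Finset.sdiff_sdiff_eq_self (Finset.mem_powerset.1 hI)]
    by_cases h0 : a.coeff I = 0
    · simp [h0]
    · have he : (-1 : ℝ) ^ (I.card * (K \ I).card) = 1 :=
        (((ZMod.natCast_eq_zero_iff_even).1 (ha I h0)).mul_right _).neg_one_pow
      have hs := sign_mul_sign (Finset.disjoint_sdiff (s := I) (t := K))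
      have hq : sign (K \ I) I * sign (K \ I) I = 1 := by
        rw [← abs_mul_abs_self, abs_sign, _root_.one_mul]
      have : sign I (K \ I) = sign (K \ I) I := by
        calc sign I (K \ I) = sign I (K \ I) * (sign (K \ I) I * sign (K \ I) I) := by
              rw [hq, _root_.mul_one]
          _ = sign (K \ I) I := by rw [← _root_.mul_assoc, hs, he, _root_.one_mul]
      rw [this]; ring

/-- The algebra `Λ⁰` of even supernumbers. -/
def EvenPart : Subalgebra ℝ Supernumber where
  carrier := {z | HasParity 0 z}
  mul_mem' := fun ha hb => by simpa using HasParity.mul ha hb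
  add_mem' := fun ha hb => HasParity.add ha hb
  algebraMap_mem' := hasParity_algebraMap

/-- The `Λ⁰`-module `Λ¹` of odd supernumbers. -/
def OddPart : Submodule EvenPart Supernumber where
  carrier := {z | HasParity 1 z}
  add_mem' := fun ha hb => HasParity.add ha hb
  zero_mem' := hasParity_zero 1
  smul_mem' := fun c _ hx => zero_add (1 : ZMod 2) ▸ HasParity.mul c.2 hx

end Supernumber

open Supernumber

/-- The superspace `ℝ^{m|n} = (Λ⁰)^m × (Λ¹)^n`. Its norm is equivalent to the sum of the norms
of the components, so that it gives the same topology and the same differentiable maps. -/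
abbrev SuperSpace (m n : ℕ) : Type := (Fin m → EvenPart) × (Fin n → OddPart)

/-- A map `f` between superspaces (or from a superspace to the supernumbers) is `G^∞` on the open
set `s` if it is smooth on `s` and superdifferentiable at each point of `s`, i.e. its Fréchet
derivative there is linear over the even supernumbers. -/
structure IsGInfty {E F : Type*} [NormedAddCommGroup E] [NormedSpace ℝ E] [SMul EvenPart E]
    [NormedAddCommGroup F] [NormedSpace ℝ F] [SMul EvenPart F] (f : E → F) (s : Set E) : Prop where
  contDiffOn : ContDiffOn ℝ ∞ f s
  fderiv_smul : ∀ x ∈ s, ∀ (a : EvenPart) (v : E), fderiv ℝ f x (a • v) = a • fderiv ℝ f x v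

theorem IsGInfty.congr {E F : Type*} [NormedAddCommGroup E] [NormedSpace ℝ E] [SMul EvenPart E]
    [NormedAddCommGroup F] [NormedSpace ℝ F] [SMul EvenPart F] {f g : E → F} {s : Set E}
    (hs : IsOpen s) (h : ∀ x ∈ s, g x = f x) (hf : IsGInfty f s) : IsGInfty g s where
  contDiffOn := hf.contDiffOn.congr h
  fderiv_smul x hx a v := by
    have : g =ᶠ[𝓝 x] f := by filter_upwards [hs.mem_nhds hx] with y hy using h y hy
    rw [this.fderiv_eq]
    exact hf.fderiv_smul x hx a v

theorem IsGInfty.differentiableAt {E F : Type*} [NormedAddCommGroup E] [NormedSpace ℝ E]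
    [SMul EvenPart E] [NormedAddCommGroup F] [NormedSpace ℝ F] [SMul EvenPart F] {f : E → F} {s : Set E}
    (hs : IsOpen s) (hf : IsGInfty f s) {x : E} (hx : x ∈ s) : DifferentiableAt ℝ f x :=
  (hf.contDiffOn.contDiffAt (hs.mem_nhds hx)).differentiableAt (by simp)

theorem IsGInfty.mono {E F : Type*} [NormedAddCommGroup E] [NormedSpace ℝ E] [SMul EvenPart E]
    [NormedAddCommGroup F] [NormedSpace ℝ F] [SMul EvenPart F] {f : E → F} {s t : Set E}
    (hf : IsGInfty f s) (h : t ⊆ s) : IsGInfty f t where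
  contDiffOn := hf.contDiffOn.mono h
  fderiv_smul x hx := hf.fderiv_smul x (h hx)

/-- The pregroupoid of `G^∞` maps on open subsets of `ℝ^{m|n}`. -/
def gInftyPregroupoid (m n : ℕ) : Pregroupoid (SuperSpace m n) where
  property f s := IsGInfty f s
  comp {f g u v} hf hg hu hv huv :=
    { contDiffOn := hg.contDiffOn.comp (hf.contDiffOn.mono inter_subset_left) fun x hx => hx.2
      fderiv_smul := fun x hx a w => by
        rw [fderiv_comp x (hg.differentiableAt hv hx.2) (hf.differentiableAt hu hx.1)]
        simp only [ContinuousLinearMap.comp_apply]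
        rw [hf.fderiv_smul x hx.1, hg.fderiv_smul _ hx.2] }
  id_mem :=
    { contDiffOn := contDiffOn_id
      fderiv_smul := fun x _ a v => by simp }
  locality {f u} hu h :=
    { contDiffOn := contDiffOn_of_locally_contDiffOn fun x hx =>
        let ⟨v, hv, hxv, hf⟩ := h x hx
        ⟨v, hv, hxv, hf.contDiffOn⟩
      fderiv_smul := fun x hx =>
        let ⟨_, _, hxv, hf⟩ := h x hx
        hf.fderiv_smul x ⟨hx, hxv⟩ }
  congr hu h hf := hf.congr hu h

/-- The groupoid of `G^∞` coordinate changes. A `G^∞` supermanifold of dimension `(m, n)` is a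
space `M` with `[ChartedSpace (SuperSpace m n) M]` and `[HasGroupoid M (gInftyGroupoid m n)]`. -/
def gInftyGroupoid (m n : ℕ) : StructureGroupoid (SuperSpace m n) :=
  (gInftyPregroupoid m n).groupoid

theorem IsGInfty.mul {E : Type*} [NormedAddCommGroup E] [NormedSpace ℝ E] [SMul EvenPart E]
    {f g : E → Supernumber} {s : Set E} (hs : IsOpen s)
    (hf : IsGInfty f s) (hg : IsGInfty g s) : IsGInfty (fun x => f x * g x) s where
  contDiffOn := hf.contDiffOn.mul hg.contDiffOn
  fderiv_smul x hx a v := by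
    have h1 := (hf.differentiableAt hs hx).hasFDerivAt.mul' (hg.differentiableAt hs hx).hasFDerivAt
    have h4 : fderiv ℝ (fun x => f x * g x) x = _ := h1.fderiv
    rw [h4]
    have h2 : ∀ w : Supernumber, f x * (a • w) = a • (f x * w) := fun w => by
      change f x * ((a : Supernumber) * w) = (a : Supernumber) * (f x * w)
      rw [← mul_assoc, ← mul_assoc, HasParity.comm a.2]
    have h3 : ∀ w : Supernumber, (a • w) * g x = a • (w * g x) := fun w =>
      mul_assoc (a : Supernumber) w (g x)
    simp only [add_apply, smul_apply,
      hf.fderiv_smul x hx, hg.fderiv_smul x hx, smul_eq_mul, MulOpposite.smul_eq_mul_unop,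
      MulOpposite.unop_op, h2, h3, smul_add]

theorem IsGInfty.add {E : Type*} [NormedAddCommGroup E] [NormedSpace ℝ E] [SMul EvenPart E]
    {f g : E → Supernumber} {s : Set E} (hs : IsOpen s)
    (hf : IsGInfty f s) (hg : IsGInfty g s) : IsGInfty (fun x => f x + g x) s where
  contDiffOn := hf.contDiffOn.add hg.contDiffOn
  fderiv_smul x hx a v := by
    rw [fderiv_fun_add (hf.differentiableAt hs hx) (hg.differentiableAt hs hx)]
    simp [hf.fderiv_smul x hx, hg.fderiv_smul x hx, smul_add]

theorem isGInfty_const {E : Type*} [NormedAddCommGroup E] [NormedSpace ℝ E] [SMul EvenPart E]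
    (c : Supernumber) (s : Set E) : IsGInfty (fun _ : E => c) s where
  contDiffOn := contDiffOn_const
  fderiv_smul x hx a v := by simp

instance {X : Type*} (l : Filter X) : Algebra ℝ (Germ l Supernumber) :=
  Algebra.ofModule
    (fun r F G => Germ.inductionOn₂ F G fun f g =>
      congrArg (Germ.ofFun (l := l)) (smul_mul_assoc r f g))
    (fun r F G => Germ.inductionOn₂ F G fun f g =>
      congrArg (Germ.ofFun (l := l)) (mul_smul_comm r f g))

section Supermanifold

variable (m n : ℕ) {M : Type*} [TopologicalSpace M] [ChartedSpace (SuperSpace m n) M]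

/-- The supernumber-valued function `f` is `G^∞` on the open set `U` of `M`. -/
def IsGInftyOn (f : M → Supernumber) (U : Set M) : Prop :=
  ∀ φ ∈ atlas (SuperSpace m n) M, IsGInfty (f ∘ φ.symm) (φ.target ∩ φ.symm ⁻¹' U)

variable {m n}

theorem IsGInftyOn.mono {f : M → Supernumber} {U V : Set M} (hf : IsGInftyOn m n f U)
    (h : V ⊆ U) : IsGInftyOn m n f V := fun φ hφ =>
  (hf φ hφ).mono (inter_subset_inter_right _ (preimage_mono h))

variable (m n)

/-- The algebra of germs at `p` of `G^∞` functions. -/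
def GInftyGerm (p : M) : Subalgebra ℝ (Germ (𝓝 p) Supernumber) where
  carrier := {F | ∃ U : Set M, IsOpen U ∧ p ∈ U ∧
    ∃ f : M → Supernumber, IsGInftyOn m n f U ∧ F = (f : Germ (𝓝 p) Supernumber)}
  mul_mem' := by
    rintro _ _ ⟨U, hU, hpU, f, hf, rfl⟩ ⟨V, hV, hpV, g, hg, rfl⟩
    exact ⟨U ∩ V, hU.inter hV, ⟨hpU, hpV⟩, f * g, fun φ hφ =>
      IsGInfty.mul (φ.isOpen_inter_preimage_symm (hU.inter hV))
        (hf.mono inter_subset_left φ hφ) (hg.mono inter_subset_right φ hφ), rfl⟩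
  add_mem' := by
    rintro _ _ ⟨U, hU, hpU, f, hf, rfl⟩ ⟨V, hV, hpV, g, hg, rfl⟩
    exact ⟨U ∩ V, hU.inter hV, ⟨hpU, hpV⟩, f + g, fun φ hφ =>
      IsGInfty.add (φ.isOpen_inter_preimage_symm (hU.inter hV))
        (hf.mono inter_subset_left φ hφ) (hg.mono inter_subset_right φ hφ), rfl⟩
  algebraMap_mem' r :=
    ⟨univ, isOpen_univ, mem_univ p, fun _ => r • (1 : Supernumber),
      fun _ _ => isGInfty_const _ _, rfl⟩

/-- `X` is a homogeneous tangent vector of parity `ε` at `p`: it maps germs of parity `δ` to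
supernumbers of parity `ε + δ`, it vanishes on constants, and it satisfies the graded Leibniz rule
`X(FG) = X(F) G(p) + (-1)^(|X||F|) F(p) X(G)`. -/
structure IsSuperderivation (p : M) (ε : ZMod 2) (X : GInftyGerm m n p →ₗ[ℝ] Supernumber) :
    Prop where
  hasParity : ∀ (δ : ZMod 2) (F : GInftyGerm m n p),
    Germ.LiftPred (HasParity δ) F.1 → HasParity (ε + δ) (X F)
  map_const : ∀ (F : GInftyGerm m n p) (c : Supernumber),
    F.1 = ((fun _ => c : M → Supernumber) : Germ (𝓝 p) Supernumber) → X F = 0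
  leibniz : ∀ (δ : ZMod 2) (F G : GInftyGerm m n p), Germ.LiftPred (HasParity δ) F.1 →
    X (F * G) = X F * G.1.value + (-1) ^ (ε.val * δ.val) * (F.1.value * X G)

/-- The tangent space `T_p M`: the left `Λ`-module generated by the homogeneous tangent vectors.
Every element of it is the sum of an even and an odd tangent vector. -/
def superTangentSubmodule (p : M) :
    Submodule Supernumber (GInftyGerm m n p →ₗ[ℝ] Supernumber) :=
  Submodule.span Supernumber {X | ∃ ε, IsSuperderivation m n p ε X}

/-- The tangent space `T_p M` as a type. -/
abbrev SuperTangent (p : M) : Type _ := superTangentSubmodule m n p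

variable {m n}

/-- `X(f)` for a tangent vector `X` at `p` and a function `f` that is `G^∞` near `p`
(the value is irrelevant, and set to zero, for other functions). -/
def SuperTangent.apply {p : M} (X : SuperTangent m n p) (f : M → Supernumber) : Supernumber :=
  open Classical in
  if h : (f : Germ (𝓝 p) Supernumber) ∈ GInftyGerm m n p then X.1 ⟨f, h⟩ else 0

/-- `X` is homogeneous of parity `ε`. -/
def SuperTangent.HasParity {p : M} (ε : ZMod 2) (X : SuperTangent m n p) : Prop :=
  IsSuperderivation m n p ε X.1

/-- `X` is a super vector field on the open set `U`: for each `G^∞` function `f` on an open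
`V ⊆ U`, the function `q ↦ X(q)(f)` is `G^∞` on `V`. The values of `X` off `U` are irrelevant. -/
def IsSuperVectorField (X : ∀ q : M, SuperTangent m n q) (U : Set M) : Prop :=
  ∀ V ⊆ U, IsOpen V → ∀ f : M → Supernumber, IsGInftyOn m n f V →
    IsGInftyOn m n (fun q => (X q).apply f) V

variable (m n M)

/-- Super Riemannian metrics on a supermanifold of dimension `(m, n)`. -/
structure SuperRiemannianMetric where
  /-- the value `g_p(X, Y)` -/
  toFun : ∀ p : M, SuperTangent m n p → SuperTangent m n p → Supernumber
  add_left : ∀ (p : M) (X Y Z : SuperTangent m n p), toFun p (X + Y) Z = toFun p X Z + toFun p Y Z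
  add_right : ∀ (p : M) (X Y Z : SuperTangent m n p), toFun p X (Y + Z) = toFun p X Y + toFun p X Z
  smul_left : ∀ (p : M) (a : Supernumber) (X Y : SuperTangent m n p),
    toFun p (a • X) Y = a * toFun p X Y
  supersymmetric : ∀ (p : M) (ε δ : ZMod 2) (X Y : SuperTangent m n p),
    X.HasParity ε → Y.HasParity δ → toFun p X Y = (-1) ^ (ε.val * δ.val) * toFun p Y X
  nondegenerate : ∀ (p : M) (Z : SuperTangent m n p), (∀ X, toFun p X Z = 0) ↔ Z = 0
  even : ∀ (p : M) (ε δ : ZMod 2) (X Y : SuperTangent m n p),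
    X.HasParity ε → Y.HasParity δ → HasParity (ε + δ) (toFun p X Y)
  smooth : ∀ (U : Set M), IsOpen U → ∀ X Y : ∀ q : M, SuperTangent m n q,
    IsSuperVectorField X U → IsSuperVectorField Y U →
      IsGInftyOn m n (fun q => toFun q (X q) (Y q)) U

variable {m n M}

/-- The even vectors `e` and the odd vectors `f` form together a basis of the `Λ`-module `T_p M`.
Equivalently, each even vector is in exactly one way of the form `∑ x^i e_i + ∑ θ^α f_α` with
`x^i` in `Λ⁰` and `θ^α` in `Λ¹`, and each odd one with `x^i` in `Λ¹` and `θ^α` in `Λ⁰`. -/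
structure IsPureBasis {p : M} {ι κ : Type*} (e : ι → SuperTangent m n p)
    (f : κ → SuperTangent m n p) : Prop where
  even : ∀ i, (e i).HasParity 0
  odd : ∀ α, (f α).HasParity 1
  linearIndependent : LinearIndependent Supernumber (Sum.elim e f)
  span_eq_top : Submodule.span Supernumber (range (Sum.elim e f)) = ⊤

/-- The vector fields `e` and `f` on the open set `U` form a pure basis at each point of `U`. -/
structure IsPureFrameOn {ι κ : Type*} (e : ι → ∀ q : M, SuperTangent m n q)
    (f : κ → ∀ q : M, SuperTangent m n q) (U : Set M) : Prop where
  isSuperVectorField_even : ∀ i, IsSuperVectorField (e i) U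
  isSuperVectorField_odd : ∀ α, IsSuperVectorField (f α) U
  isPureBasis : ∀ q ∈ U, IsPureBasis (fun i => e i q) (fun α => f α q)

/-- The matrix `Γ_g` of `g_p` relative to the vectors `e`, `f`. -/
def SuperRiemannianMetric.gram (g : SuperRiemannianMetric m n M) {p : M} {ι κ : Type*}
    (e : ι → SuperTangent m n p) (f : κ → SuperTangent m n p) :
    Matrix (ι ⊕ κ) (ι ⊕ κ) Supernumber :=
  Matrix.of fun a b => g.toFun p (Sum.elim e f a) (Sum.elim e f b)

end Supermanifold

/-- The standard symplectic matrix, with `l` diagonal blocks `J = (0 1; -1 0)`; the index `(r, k)`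
is the `r`-th index of the `k`-th block. -/
def standardSymplectic (l : ℕ) : Matrix (Fin 2 × Fin l) (Fin 2 × Fin l) Supernumber :=
  Matrix.blockDiagonal fun _ => !![0, 1; -1, 0]

/-- The block matrix with blocks `η = diag(d_1, …, d_m)` and the standard symplectic matrix. -/
def canonicalMatrix {m : ℕ} (l : ℕ) (d : Fin m → Supernumber) :
    Matrix (Fin m ⊕ Fin 2 × Fin l) (Fin m ⊕ Fin 2 × Fin l) Supernumber :=
  Matrix.fromBlocks (Matrix.diagonal d) 0 0 (standardSymplectic l)

/-- The condition `‖s(d)‖ / |β(d)| < 1`, which presupposes `β(d) ≠ 0`. -/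
def SoulBodyRatioLtOne (d : Supernumber) : Prop :=
  d.body ≠ 0 ∧ ‖d.soul‖ / |d.body| < 1

/-- `lam = |β(d)|^(-1/2) (1 + μ)^(-1/2)` with `μ = s(d) / β(d)`, where the last factor is the sum of
the binomial series `∑ₖ choose(-1/2, k) μ^k`. -/
def IsBinomialScaling (d lam : Supernumber) : Prop :=
  HasSum (fun k : ℕ => ((√|d.body|)⁻¹ * Ring.choose (-1 / 2 : ℝ) k) • (d.body⁻¹ • d.soul) ^ k) lam

end

/-!
The inverse square root of `d = β(d) (1 + μ)` with `‖μ‖ < 1` is a binomial series, and Vandermonde's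
identity for the coefficients turns into `λ² d = sign β(d)`, which gives the diagonal entries `±1`.

The delicate point is that `λ` is `G^∞`: body and soul are smooth but their derivatives are not
`Λ⁰`-linear, so the formula for `λ` shows smoothness only. Differentiating `λ² d = sign β(d)`, whose
right-hand side is locally constant, gives `λ' = -½ sign(β(d)) λ³ d'`, an even multiple of the
`Λ⁰`-linear map `d'`.

Since `‖d‖ = |β(d)| + ‖s(d)‖`, the inequality `‖s(d)‖ < |β(d)|` says `‖s(d)‖ < 1/2` as soon as
`‖d‖ = 1`, and real rescaling does not affect it. Nondegeneracy of the metric makes `d ≠ 0`, so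
that this normalization is possible.
-/

section BinomialSeries

open FormalMultilinearSeries

theorem radius_ofScalars_self_le {𝕜 : Type*} (A : Type*) [NontriviallyNormedField 𝕜] [NormedRing A]
    [NormedAlgebra 𝕜 A] (c : ℕ → 𝕜) : (ofScalars 𝕜 c).radius ≤ (ofScalars A c).radius := by
  refine ENNReal.le_of_forall_nnreal_lt fun r hr => ?_
  obtain ⟨C, -, hC⟩ := (ofScalars 𝕜 c).norm_mul_pow_le_of_lt_radius hr
  refine (ofScalars A c).le_radius_of_eventually_le C ?_
  filter_upwards [eventually_gt_atTop 0] with n hn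
  calc ‖ofScalars A c n‖ * (r : ℝ) ^ n ≤ ‖ofScalars 𝕜 c n‖ * (r : ℝ) ^ n := by
        gcongr
        exact (ofScalars_norm_le A c n hn).trans_eq (ofScalars_norm (E := 𝕜) c n).symm
    _ ≤ C := hC n

variable {𝕂 A : Type*} [RCLike 𝕂] [NormedRing A] [NormedAlgebra 𝕂 A]

theorem mem_eball_radius_binomialSeries (a : 𝕂) {x : A} (hx : ‖x‖ < 1) :
    x ∈ Metric.eball 0 (binomialSeries A a).radius := by
  have one_le_radius : 1 ≤ (binomialSeries A a).radius :=
    binomialSeries_radius_ge_one.trans (radius_ofScalars_self_le A (Ring.choose a ·))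
  rw [Metric.mem_eball, edist_zero_right]
  exact lt_of_lt_of_le (by rw [enorm_eq_nnnorm]; exact_mod_cast hx) one_le_radius

theorem summable_norm_choose_smul_pow (a : 𝕂) {x : A} (hx : ‖x‖ < 1) :
    Summable fun k : ℕ => ‖Ring.choose a k • x ^ k‖ := by
  simpa using (binomialSeries A a).summable_norm_apply (mem_eball_radius_binomialSeries a hx)

theorem binomialSeries_sum_eq_tsum (a : 𝕂) (x : A) :
    (binomialSeries A a).sum x = ∑' k : ℕ, Ring.choose a k • x ^ k := by
  simp [FormalMultilinearSeries.sum]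

theorem binomialSeries_sum_natCast (n : ℕ) (x : A) :
    (binomialSeries A (n : 𝕂)).sum x = (1 + x) ^ n := by
  rw [binomialSeries_sum_eq_tsum, add_comm, (Commute.one_right x).add_pow,
    tsum_eq_sum (s := Finset.range (n + 1))]
  · simp [Ring.choose_natCast, Nat.cast_smul_eq_nsmul, ← Nat.cast_comm]
  · intro k hk
    rw [Ring.choose_natCast, Nat.choose_eq_zero_of_lt (by simpa using hk), Nat.cast_zero, zero_smul]

variable [CompleteSpace A]

theorem hasSum_binomialSeries (a : 𝕂) {x : A} (hx : ‖x‖ < 1) :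
    HasSum (fun k : ℕ => Ring.choose a k • x ^ k) ((binomialSeries A a).sum x) := by
  simpa using (binomialSeries A a).hasSum (mem_eball_radius_binomialSeries a hx)

theorem analyticAt_binomialSeries_sum (a : 𝕂) {x : A} (hx : ‖x‖ < 1) :
    AnalyticAt 𝕂 (binomialSeries A a).sum x :=
  have hx' := mem_eball_radius_binomialSeries a hx
  ((binomialSeries A a).hasFPowerSeriesOnBall (pos_of_gt hx')).analyticAt_of_mem hx'

theorem binomialSeries_sum_add (a b : 𝕂) {x : A} (hx : ‖x‖ < 1) :
    (binomialSeries A (a + b)).sum x = (binomialSeries A a).sum x * (binomialSeries A b).sum x := by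
  simp only [binomialSeries_sum_eq_tsum]
  rw [tsum_mul_tsum_eq_tsum_sum_antidiagonal_of_summable_norm
    (summable_norm_choose_smul_pow a hx) (summable_norm_choose_smul_pow b hx)]
  refine tsum_congr fun k => ?_
  rw [Ring.add_choose_eq k (Commute.all a b), Finset.sum_smul]
  refine Finset.sum_congr rfl fun ij hij => ?_
  rw [smul_mul_smul_comm, ← pow_add, Finset.HasAntidiagonal.mem_antidiagonal.1 hij]

theorem binomialSeries_sum_neg_half_mul_self_mul {x : A} (hx : ‖x‖ < 1) :
    (binomialSeries A (-1 / 2 : 𝕂)).sum x * (binomialSeries A (-1 / 2 : 𝕂)).sum x * (1 + x) = 1 :=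
  calc (binomialSeries A (-1 / 2 : 𝕂)).sum x * (binomialSeries A (-1 / 2 : 𝕂)).sum x * (1 + x)
      = (binomialSeries A (-1 / 2 + -1 / 2 + (1 : ℕ) : 𝕂)).sum x := by
        rw [binomialSeries_sum_add _ _ hx, binomialSeries_sum_add _ _ hx,
          binomialSeries_sum_natCast, pow_one]
    _ = (binomialSeries A ((0 : ℕ) : 𝕂)).sum x := by norm_num
    _ = 1 := by rw [binomialSeries_sum_natCast, pow_zero]

end BinomialSeries

namespace Supernumber

instance : Nontrivial Supernumber :=
  nontrivial_of_ne 1 0 fun h => one_ne_zero (α := ℝ) (congrArg (fun z : Supernumber => z.coeff ∅) h)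

/-- The coefficient `z_I` as a continuous linear functional of `z`. -/
noncomputable def coeffCLM (I : Finset ℕ) : Supernumber →L[ℝ] ℝ :=
  LinearMap.mkContinuous
    { toFun := fun z => z.coeff I
      map_add' := fun _ _ => rfl
      map_smul' := fun _ _ => rfl } 1 fun z => by
    rw [one_mul, norm_eq]
    exact z.summable_abs_coeff.le_tsum I fun _ _ => abs_nonneg _

theorem contDiff_body {k : WithTop ℕ∞} : ContDiff ℝ k body := (coeffCLM ∅).contDiff

theorem contDiff_soul {k : WithTop ℕ∞} : ContDiff ℝ k soul :=
  contDiff_id.sub ((algebraMapCLM ℝ Supernumber).contDiff.comp contDiff_body)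

theorem continuous_body : Continuous body := (contDiff_body (k := 0)).continuous

theorem continuous_soul : Continuous soul := (contDiff_soul (k := 0)).continuous

theorem isClosed_setOf_hasParity (ε : ZMod 2) : IsClosed {z : Supernumber | HasParity ε z} := by
  simp only [HasParity, ofPred_forall]
  refine isClosed_iInter fun I => ?_
  by_cases hI : (I.card : ZMod 2) = ε
  · simp [hI]
  · simpa [hI] using isClosed_eq (f := fun z : Supernumber => z.coeff I)
      (coeffCLM I).continuous continuous_const

theorem coeff_soul (z : Supernumber) (I : Finset ℕ) :
    z.soul.coeff I = if I = ∅ then 0 else z.coeff I := by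
  rw [soul, coeff_sub, Algebra.algebraMap_eq_smul_one, coeff_smul, coeff_one, body]
  split_ifs with h <;> simp [h]

theorem norm_eq_abs_body_add_norm_soul (z : Supernumber) : ‖z‖ = |z.body| + ‖z.soul‖ := by
  rw [norm_eq, norm_eq, z.summable_abs_coeff.tsum_eq_add_tsum_ite ∅, body]
  congr 1
  refine tsum_congr fun I => ?_
  rw [coeff_soul]
  split_ifs <;> simp

theorem body_smul (r : ℝ) (z : Supernumber) : (r • z).body = r * z.body := rfl

theorem soul_smul (r : ℝ) (z : Supernumber) : (r • z).soul = r • z.soul := by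
  rw [soul, soul, body_smul, smul_sub, map_mul, ← Algebra.smul_def]

theorem body_smul_one_add_inv_body_smul_soul {z : Supernumber} (hz : z.body ≠ 0) :
    z.body • (1 + z.body⁻¹ • z.soul) = z := by
  rw [smul_add, smul_inv_smul₀ hz, ← Algebra.algebraMap_eq_smul_one, soul, add_sub_cancel]

theorem soul_mem_evenPart {z : Supernumber} (hz : z ∈ EvenPart) : z.soul ∈ EvenPart :=
  EvenPart.sub_mem hz (EvenPart.algebraMap_mem _)

theorem soulBodyRatioLtOne_iff (d : Supernumber) :
    SoulBodyRatioLtOne d ↔ ‖d.soul‖ < |d.body| := by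
  constructor
  · rintro ⟨hd, h⟩
    rwa [div_lt_one (abs_pos.2 hd)] at h
  · intro h
    have hd : 0 < |d.body| := (norm_nonneg _).trans_lt h
    exact ⟨abs_pos.1 hd, (div_lt_one hd).2 h⟩

theorem soulBodyRatioLtOne_iff_of_norm_eq_one {d : Supernumber} (hd : ‖d‖ = 1) :
    SoulBodyRatioLtOne d ↔ ‖d.soul‖ < 1 / 2 := by
  rw [norm_eq_abs_body_add_norm_soul] at hd
  rw [soulBodyRatioLtOne_iff]
  constructor <;> intro h <;> linarith

theorem soulBodyRatioLtOne_smul {r : ℝ} (hr : r ≠ 0) (d : Supernumber) :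
    SoulBodyRatioLtOne (r • d) ↔ SoulBodyRatioLtOne d := by
  rw [soulBodyRatioLtOne_iff, soulBodyRatioLtOne_iff, soul_smul, body_smul, norm_smul, abs_mul,
    Real.norm_eq_abs, mul_lt_mul_iff_right₀ (abs_pos.2 hr)]

theorem eventually_soulBodyRatioLtOne {d : Supernumber} (hd : SoulBodyRatioLtOne d) :
    ∀ᶠ z in 𝓝 d, SoulBodyRatioLtOne z := by
  simp only [soulBodyRatioLtOne_iff] at hd ⊢
  exact continuous_soul.norm.continuousAt.eventually_lt continuous_body.abs.continuousAt hd

theorem eventually_sign_body_eq {d : Supernumber} (hd : d.body ≠ 0) :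
    ∀ᶠ z in 𝓝 d, SignType.sign z.body = SignType.sign d.body :=
  have sign_body_continuousAt : ContinuousAt (fun z : Supernumber => SignType.sign z.body) d :=
    (continuousAt_sign_of_ne_zero hd).comp continuous_body.continuousAt
  sign_body_continuousAt.eventually_mem ((isOpen_discrete {SignType.sign d.body}).mem_nhds rfl)

theorem exists_isOpen_soulBodyRatioLtOne_and_sign_body_eq {X ι : Type*} [TopologicalSpace X]
    [Finite ι] {U : Set X} (hU : IsOpen U) {x : X} (hx : x ∈ U) {d : ι → X → Supernumber}
    (hd : ∀ i, ContinuousAt (d i) x) (hr : ∀ i, SoulBodyRatioLtOne (d i x)) :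
    ∃ V ⊆ U, IsOpen V ∧ x ∈ V ∧ (∀ y ∈ V, ∀ i, SoulBodyRatioLtOne (d i y)) ∧
      ∀ y ∈ V, ∀ i, SignType.sign (d i y).body = SignType.sign (d i x).body := by
  have eventually_near_x : ∀ᶠ y in 𝓝 x, y ∈ U ∧ ∀ i, SoulBodyRatioLtOne (d i y) ∧
      SignType.sign (d i y).body = SignType.sign (d i x).body :=
    (hU.eventually_mem hx).and <| eventually_all.2 fun i => (hd i).eventually <|
      (eventually_soulBodyRatioLtOne (hr i)).and (eventually_sign_body_eq (hr i).1)
  obtain ⟨V, hV, hVo, hxV⟩ := eventually_nhds_iff.1 eventually_near_x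
  exact ⟨V, fun y hy => (hV y hy).1, hVo, hxV, fun y hy i => ((hV y hy).2 i).1,
    fun y hy i => ((hV y hy).2 i).2⟩

theorem norm_inv_body_smul_soul_lt_one {d : Supernumber} (hd : SoulBodyRatioLtOne d) :
    ‖d.body⁻¹ • d.soul‖ < 1 := by
  rw [norm_smul, norm_inv, Real.norm_eq_abs, inv_mul_eq_div]
  exact hd.2

/-- The scaling `λ = |β(d)|^(-1/2) (1 + s(d) / β(d))^(-1/2)`, the second factor being the sum of
the binomial series; it is meaningful only for `‖s(d)‖ < |β(d)|`. -/
noncomputable def binomialScaling (d : Supernumber) : Supernumber :=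
  (√|d.body|)⁻¹ • (binomialSeries Supernumber (-1 / 2 : ℝ)).sum (d.body⁻¹ • d.soul)

theorem isBinomialScaling_binomialScaling {d : Supernumber} (hd : SoulBodyRatioLtOne d) :
    IsBinomialScaling d (binomialScaling d) := by
  simp only [IsBinomialScaling, binomialScaling, ← smul_smul]
  exact (hasSum_binomialSeries _ (norm_inv_body_smul_soul_lt_one hd)).const_smul _

theorem binomialScaling_mem_evenPart {d : Supernumber} (hd : d ∈ EvenPart) :
    binomialScaling d ∈ EvenPart := by
  refine EvenPart.smul_mem (FormalMultilinearSeries.sum_mem (isClosed_setOf_hasParity 0) _ _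
    fun k => ?_) _
  rw [binomialSeries_apply, List.ofFn_const, List.prod_replicate]
  exact EvenPart.smul_mem (pow_mem (EvenPart.smul_mem (soul_mem_evenPart hd) _) k) _

theorem binomialScaling_mul_self_mul {d : Supernumber} (hd : SoulBodyRatioLtOne d) :
    binomialScaling d * binomialScaling d * d = (SignType.sign d.body : Supernumber) := by
  have factor_mul_self : (√|d.body|)⁻¹ * (√|d.body|)⁻¹ * d.body = SignType.sign d.body := by
    rw [← mul_inv, Real.mul_self_sqrt (abs_nonneg _), inv_mul_eq_iff_eq_mul₀ (abs_ne_zero.2 hd.1),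
      abs_mul_sign]
  calc binomialScaling d * binomialScaling d * d
      = binomialScaling d * binomialScaling d * (d.body • (1 + d.body⁻¹ • d.soul)) := by
        rw [body_smul_one_add_inv_body_smul_soul hd.1]
    _ = (SignType.sign d.body : ℝ) • (1 : Supernumber) := by
        rw [binomialScaling, smul_mul_smul_comm (√|d.body|)⁻¹ _ (√|d.body|)⁻¹ _,
          smul_mul_smul_comm _ _ d.body, factor_mul_self,
          binomialSeries_sum_neg_half_mul_self_mul (norm_inv_body_smul_soul_lt_one hd)]
    _ = (SignType.sign d.body : Supernumber) := by
        rcases hd.1.lt_or_gt with h | h <;> simp [h]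

theorem isUnit_binomialScaling {d : Supernumber} (hd : SoulBodyRatioLtOne d) (hd₀ : d ∈ EvenPart) :
    IsUnit (binomialScaling d) := by
  have hu : IsUnit (binomialScaling d * (binomialScaling d * d)) := by
    rw [← mul_assoc, binomialScaling_mul_self_mul hd]
    rcases hd.1.lt_or_gt with h | h <;> simp [h]
  exact ((Commute.isUnit_mul_iff (HasParity.comm (binomialScaling_mem_evenPart hd₀) _)).1 hu).1

theorem contDiffAt_binomialScaling {d : Supernumber} (hd : SoulBodyRatioLtOne d) :
    ContDiffAt ℝ ∞ binomialScaling d := by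
  have body_contDiffAt : ContDiffAt ℝ ∞ body d := contDiff_body.contDiffAt
  have abs_body_ne_zero : |d.body| ≠ 0 := abs_ne_zero.2 hd.1
  refine (((body_contDiffAt.abs hd.1).sqrt abs_body_ne_zero).inv
    (Real.sqrt_ne_zero'.2 (abs_pos.2 hd.1))).smul ?_
  exact (analyticAt_binomialSeries_sum _ (norm_inv_body_smul_soul_lt_one hd)).contDiffAt.comp d
    ((body_contDiffAt.inv hd.1).smul contDiff_soul.contDiffAt)

end Supernumber

open Supernumber

theorem two_smul_mul_fderiv_of_mul_self_mul_eq_const {𝕜 E A : Type*} [NontriviallyNormedField 𝕜]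
    [NormedAddCommGroup E] [NormedSpace 𝕜 E] [NormedRing A] [NormedAlgebra 𝕜 A] {f h : E → A}
    {x : E} {c : A} (hf : DifferentiableAt 𝕜 f x) (hh : DifferentiableAt 𝕜 h x)
    (f_comm : ∀ a, Commute (f x) a) (h_comm : ∀ a, Commute (h x) a)
    (hc : (fun y => h y * h y * f y) =ᶠ[𝓝 x] fun _ => c) (w : E) :
    (2 : 𝕜) • (c * fderiv 𝕜 h x w) = -(h x ^ 3 * fderiv 𝕜 f x w) := by
  have leibniz : h x * h x * fderiv 𝕜 f x w
      + (h x * fderiv 𝕜 h x w + fderiv 𝕜 h x w * h x) * f x = 0 :=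
    DFunLike.congr_fun (((hh.hasFDerivAt.mul' hh.hasFDerivAt).mul' hf.hasFDerivAt).unique
      ((hasFDerivAt_const c x).congr_of_eventuallyEq hc)) w
  rw [← (f_comm _).eq, ← (h_comm (fderiv 𝕜 h x w)).eq, ← two_smul 𝕜 (h x * _), mul_smul_comm]
    at leibniz
  calc (2 : 𝕜) • (c * fderiv 𝕜 h x w)
      = h x * (2 : 𝕜) • (f x * (h x * fderiv 𝕜 h x w)) := by
        rw [← hc.eq_of_nhds, mul_smul_comm, mul_assoc (h x) (h x), ← (f_comm (h x)).eq]
        simp only [mul_assoc]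
    _ = h x * -(h x * h x * fderiv 𝕜 f x w) := by rw [eq_neg_of_add_eq_zero_right leibniz]
    _ = -(h x ^ 3 * fderiv 𝕜 f x w) := by rw [pow_three, mul_neg]; simp only [mul_assoc]

section IsGInfty

variable {E : Type*} [NormedAddCommGroup E] [NormedSpace ℝ E] {f h : E → Supernumber}

theorem IsGInfty.of_fderiv_eq_mul [SMul EvenPart E] {s : Set E} (hf : IsGInfty f s)
    (hh : ContDiffOn ℝ ∞ h s)
    (hfh : ∀ x ∈ s, ∃ k ∈ EvenPart, ∀ w, fderiv ℝ h x w = k * fderiv ℝ f x w) :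
    IsGInfty h s where
  contDiffOn := hh
  fderiv_smul x hx a v := by
    obtain ⟨k, hk, hfderiv⟩ := hfh x hx
    rw [hfderiv, hfderiv, hf.fderiv_smul x hx, Subalgebra.smul_def, Subalgebra.smul_def,
      smul_eq_mul, smul_eq_mul, ← mul_assoc, HasParity.comm hk, mul_assoc]

theorem fderiv_binomialScaling_comp {x : E} (hf : DifferentiableAt ℝ f x)
    (hr : SoulBodyRatioLtOne (f x)) (he : f x ∈ EvenPart) (w : E) :
    fderiv ℝ (fun y => binomialScaling (f y)) x w =
      (-1 / 2 : ℝ) • (SignType.sign (f x).body * binomialScaling (f x) ^ 3) * fderiv ℝ f x w := by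
  have hh : DifferentiableAt ℝ (fun y => binomialScaling (f y)) x :=
    ((contDiffAt_binomialScaling hr).differentiableAt (by simp)).comp x hf
  have eventually_const : (fun y => binomialScaling (f y) * binomialScaling (f y) * f y)
      =ᶠ[𝓝 x] fun _ => (SignType.sign (f x).body : Supernumber) := by
    filter_upwards [hf.continuousAt.eventually (eventually_soulBodyRatioLtOne hr),
      hf.continuousAt.eventually (eventually_sign_body_eq hr.1)] with y hy hsign
    rw [binomialScaling_mul_self_mul hy, hsign]
  have sign_mul_sign : (SignType.sign (f x).body * SignType.sign (f x).body : Supernumber) = 1 := by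
    rcases hr.1.lt_or_gt with h | h <;> simp [h]
  have hw := two_smul_mul_fderiv_of_mul_self_mul_eq_const hf hh (HasParity.comm he)
    (HasParity.comm (binomialScaling_mem_evenPart he)) eventually_const w
  rw [smul_mul_assoc, mul_assoc, ← neg_eq_iff_eq_neg.2 hw, mul_neg, mul_smul_comm, ← mul_assoc,
    sign_mul_sign, one_mul, smul_neg, smul_smul, ← neg_smul]
  norm_num

theorem IsGInfty.binomialScaling [SMul EvenPart E] {s : Set E} (hs : IsOpen s)
    (hf : IsGInfty f s) (hr : ∀ x ∈ s, SoulBodyRatioLtOne (f x)) (he : ∀ x ∈ s, f x ∈ EvenPart) :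
    IsGInfty (fun x => Supernumber.binomialScaling (f x)) s := by
  have scaling_contDiffOn : ContDiffOn ℝ ∞ (fun x => Supernumber.binomialScaling (f x)) s :=
    fun x hx => (contDiffAt_binomialScaling (hr x hx)).comp_contDiffWithinAt x (hf.contDiffOn x hx)
  have sign_even : ∀ x ∈ s, (SignType.sign (f x).body : Supernumber) ∈ EvenPart := by
    intro x hx
    rcases (hr x hx).1.lt_or_gt with h | h <;> simp [h]
  exact hf.of_fderiv_eq_mul scaling_contDiffOn fun x hx =>
    ⟨_, EvenPart.smul_mem (EvenPart.mul_mem (sign_even x hx)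
      (EvenPart.pow_mem (binomialScaling_mem_evenPart (he x hx)) 3)) (-1 / 2),
      fderiv_binomialScaling_comp (hf.differentiableAt hs hx) (hr x hx) (he x hx)⟩

end IsGInfty

section Supermanifold

variable {m n : ℕ} {M : Type*} [TopologicalSpace M] [ChartedSpace (SuperSpace m n) M] {p : M}
  {U V : Set M} {ι κ : Type*}

theorem IsGInftyOn.congr {φ ψ : M → Supernumber} (hU : IsOpen U) (h : ∀ q ∈ U, ψ q = φ q)
    (hφ : IsGInftyOn m n φ U) : IsGInftyOn m n ψ U := fun x hx =>
  (hφ x hx).congr (x.isOpen_inter_preimage_symm hU) fun _ hy => h _ hy.2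

theorem IsGInftyOn.mul {φ ψ : M → Supernumber} (hU : IsOpen U) (hφ : IsGInftyOn m n φ U)
    (hψ : IsGInftyOn m n ψ U) : IsGInftyOn m n (fun q => φ q * ψ q) U := fun x hx =>
  (hφ x hx).mul (x.isOpen_inter_preimage_symm hU) (hψ x hx)

theorem IsGInftyOn.binomialScaling {φ : M → Supernumber} (hU : IsOpen U)
    (hφ : IsGInftyOn m n φ U) (hr : ∀ q ∈ U, SoulBodyRatioLtOne (φ q))
    (he : ∀ q ∈ U, φ q ∈ EvenPart) :
    IsGInftyOn m n (fun q => Supernumber.binomialScaling (φ q)) U := fun x hx =>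
  (hφ x hx).binomialScaling (x.isOpen_inter_preimage_symm hU) (fun _ hy => hr _ hy.2)
    fun _ hy => he _ hy.2

theorem IsGInftyOn.continuousAt {φ : M → Supernumber} (hU : IsOpen U) (hφ : IsGInftyOn m n φ U)
    (hp : p ∈ U) : ContinuousAt φ p := by
  set x := chartAt (SuperSpace m n) p
  have p_mem : p ∈ x.symm.target := mem_chart_source _ p
  rw [x.symm.continuousAt_iff_continuousAt_comp_right p_mem]
  exact ((hφ x (chart_mem_atlas _ p)).differentiableAt (x.isOpen_inter_preimage_symm hU)
    ⟨x.symm.map_target p_mem, by rwa [mem_preimage, x.symm.right_inv p_mem]⟩).continuousAt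

namespace SuperTangent

theorem apply_smul (a : Supernumber) (X : SuperTangent m n p) (φ : M → Supernumber) :
    (a • X).apply φ = a * X.apply φ := by
  unfold SuperTangent.apply
  split_ifs
  · rfl
  · rw [mul_zero]

theorem HasParity.smul {ε : ZMod 2} {a : Supernumber} {X : SuperTangent m n p}
    (hX : X.HasParity ε) (ha : a ∈ EvenPart) : (a • X).HasParity ε where
  hasParity δ F hF := by
    simpa using Supernumber.HasParity.mul ha (IsSuperderivation.hasParity hX δ F hF)
  map_const F c hF := by
    change a * X.1 F = 0
    rw [IsSuperderivation.map_const hX F c hF, mul_zero]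
  leibniz δ F G hF := by
    change a * X.1 (F * G) = a * X.1 F * G.1.value + (-1) ^ (ε.val * δ.val) *
      (F.1.value * (a * X.1 G))
    have a_comm : ∀ b, a * b = b * a := Supernumber.HasParity.comm ha
    rw [IsSuperderivation.leibniz hX δ F G hF, mul_add, ← mul_assoc a (X.1 F), a_comm (_ * _),
      a_comm (X.1 G), mul_assoc, mul_assoc, mul_assoc]

end SuperTangent

theorem IsSuperVectorField.mono {X : ∀ q : M, SuperTangent m n q} (hX : IsSuperVectorField X U)
    (h : V ⊆ U) : IsSuperVectorField X V :=
  fun W hW => hX W (hW.trans h)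

theorem IsSuperVectorField.smul {X : ∀ q : M, SuperTangent m n q} {a : M → Supernumber}
    (hX : IsSuperVectorField X U) (ha : IsGInftyOn m n a U) :
    IsSuperVectorField (fun q => a q • X q) U := by
  intro V hV hVo φ hφ
  simp only [SuperTangent.apply_smul]
  exact (ha.mono hV).mul hVo (hX V hV hVo φ hφ)

theorem IsPureBasis.smul {e : ι → SuperTangent m n p} {f : κ → SuperTangent m n p}
    (h : IsPureBasis e f) {a : ι → Supernumber} (hu : ∀ i, IsUnit (a i))
    (ha : ∀ i, a i ∈ EvenPart) : IsPureBasis (fun i => a i • e i) f := by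
  have units_smul : Sum.elim (fun i => a i • e i) f
      = (Sum.elim (fun i => (hu i).unit) fun _ => 1 : ι ⊕ κ → Supernumberˣ) • Sum.elim e f := by
    ext1 (i | α)
    · rfl
    · exact (one_smul Supernumberˣ (f α)).symm
  refine ⟨fun i => (h.even i).smul (ha i), h.odd, ?_, ?_⟩ <;> rw [units_smul]
  · exact h.linearIndependent.units_smul _
  · exact Module.Basis.units_smul_span_eq_top h.span_eq_top

theorem IsPureFrameOn.mono {e : ι → ∀ q : M, SuperTangent m n q}
    {f : κ → ∀ q : M, SuperTangent m n q} (h : IsPureFrameOn e f U) (hV : V ⊆ U) :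
    IsPureFrameOn e f V where
  isSuperVectorField_even i := (h.isSuperVectorField_even i).mono hV
  isSuperVectorField_odd α := (h.isSuperVectorField_odd α).mono hV
  isPureBasis q hq := h.isPureBasis q (hV hq)

theorem IsPureFrameOn.smul {e : ι → ∀ q : M, SuperTangent m n q}
    {f : κ → ∀ q : M, SuperTangent m n q} (h : IsPureFrameOn e f U) {a : ι → M → Supernumber}
    (hs : ∀ i, IsGInftyOn m n (a i) U) (hu : ∀ q ∈ U, ∀ i, IsUnit (a i q))
    (ha : ∀ q ∈ U, ∀ i, a i q ∈ EvenPart) : IsPureFrameOn (fun i q => a i q • e i q) f U where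
  isSuperVectorField_even i := (h.isSuperVectorField_even i).smul (hs i)
  isSuperVectorField_odd := h.isSuperVectorField_odd
  isPureBasis q hq := (h.isPureBasis q hq).smul (hu q hq) (ha q hq)

theorem IsPureFrameOn.binomialScaling_smul {e : ι → ∀ q : M, SuperTangent m n q}
    {f : κ → ∀ q : M, SuperTangent m n q} (h : IsPureFrameOn e f U) (hU : IsOpen U)
    {d : ι → M → Supernumber} (hd : ∀ i, IsGInftyOn m n (d i) U)
    (hr : ∀ q ∈ U, ∀ i, SoulBodyRatioLtOne (d i q)) (he : ∀ q ∈ U, ∀ i, d i q ∈ EvenPart) :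
    IsPureFrameOn (fun i q => binomialScaling (d i q) • e i q) f U :=
  h.smul (fun i => (hd i).binomialScaling hU (fun q hq => hr q hq i) fun q hq => he q hq i)
    (fun q hq i => isUnit_binomialScaling (hr q hq i) (he q hq i))
    fun q hq i => binomialScaling_mem_evenPart (he q hq i)

theorem diagonal_mul_canonicalMatrix_mul_diagonal {m : ℕ} (l : ℕ) (a d : Fin m → Supernumber) :
    Matrix.diagonal (Sum.elim a 1) * canonicalMatrix l d * Matrix.diagonal (Sum.elim a 1) =
      canonicalMatrix l fun i => a i * d i * a i := by
  simp [canonicalMatrix, ← Matrix.fromBlocks_diagonal, Matrix.fromBlocks_multiply]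

namespace SuperRiemannianMetric

variable (g : SuperRiemannianMetric m n M)

theorem smul_right {ε δ : ZMod 2} {X Y : SuperTangent m n p} (hX : X.HasParity ε)
    (hY : Y.HasParity δ) {a : Supernumber} (ha : a ∈ EvenPart) :
    g.toFun p X (a • Y) = g.toFun p X Y * a := by
  rw [g.supersymmetric p ε δ X _ hX (hY.smul ha), g.smul_left, g.supersymmetric p ε δ X Y hX hY,
    HasParity.comm ha, mul_assoc]

theorem eq_zero_of_span_eq_top {v : ι → SuperTangent m n p}
    (hv : Submodule.span Supernumber (range v) = ⊤) {Z : SuperTangent m n p}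
    (hZ : ∀ i, g.toFun p (v i) Z = 0) : Z = 0 := by
  refine (g.nondegenerate p Z).1 fun X => ?_
  have hX : X ∈ Submodule.span Supernumber (range v) := hv ▸ Submodule.mem_top
  induction hX using Submodule.span_induction with
  | mem _ h =>
    obtain ⟨i, rfl⟩ := h
    exact hZ i
  | zero => simpa using g.smul_left p 0 0 Z
  | add X Y _ _ hX hY => rw [g.add_left, hX, hY, add_zero]
  | smul a X _ hX => rw [g.smul_left, hX, mul_zero]

theorem gram_smul [Fintype ι] [DecidableEq ι] [Fintype κ] [DecidableEq κ]
    {e : ι → SuperTangent m n p} {f : κ → SuperTangent m n p} (he : ∀ i, (e i).HasParity 0)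
    (hf : ∀ α, (f α).HasParity 1) {a : ι → Supernumber} (ha : ∀ i, a i ∈ EvenPart) :
    g.gram (fun i => a i • e i) f =
      Matrix.diagonal (Sum.elim a 1) * g.gram e f * Matrix.diagonal (Sum.elim a 1) := by
  ext1 (i | α) (j | β) <;>
    simp only [gram, Matrix.diagonal_mul, Matrix.mul_diagonal, Matrix.of_apply, Sum.elim_inl,
      Sum.elim_inr, Pi.one_apply, one_mul, mul_one]
  · rw [g.smul_left, g.smul_right (he i) (he j) (ha j), mul_assoc]
  · rw [g.smul_left]
  · rw [g.smul_right (hf α) (he j) (ha j)]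

section CanonicalGram

variable {k l : ℕ} {e : Fin k → SuperTangent m n p} {f : Fin 2 × Fin l → SuperTangent m n p}
  {d : Fin k → Supernumber}

theorem gram_smul_eq_canonicalMatrix (hef : IsPureBasis e f) (hg : g.gram e f = canonicalMatrix l d)
    {a : Fin k → Supernumber} (ha : ∀ i, a i ∈ EvenPart) :
    g.gram (fun i => a i • e i) f = canonicalMatrix l fun i => a i * a i * d i := by
  rw [g.gram_smul hef.even hef.odd ha, hg, diagonal_mul_canonicalMatrix_mul_diagonal]
  congr! 2 with i
  rw [mul_assoc, mul_assoc, HasParity.comm (ha i) (d i)]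

variable {g}

theorem toFun_eq_of_gram_eq_canonicalMatrix (hg : g.gram e f = canonicalMatrix l d) (i : Fin k) :
    g.toFun p (e i) (e i) = d i := by
  simpa [gram, canonicalMatrix] using congrFun₂ hg (Sum.inl i) (Sum.inl i)

theorem diag_mem_evenPart (he : ∀ i, (e i).HasParity 0) (hg : g.gram e f = canonicalMatrix l d)
    (i : Fin k) : d i ∈ EvenPart := by
  rw [← toFun_eq_of_gram_eq_canonicalMatrix hg i]
  exact g.even p 0 0 _ _ (he i) (he i)

theorem diag_ne_zero (hef : IsPureBasis e f) (hg : g.gram e f = canonicalMatrix l d) (i : Fin k) :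
    d i ≠ 0 := by
  intro hd
  refine hef.linearIndependent.ne_zero (Sum.inl i) (g.eq_zero_of_span_eq_top hef.span_eq_top ?_)
  intro s
  refine (congrFun₂ hg s (Sum.inl i)).trans ?_
  rcases s with j | _
  · by_cases hji : j = i <;> simp [canonicalMatrix, hji, hd]
  · simp [canonicalMatrix]

theorem gram_binomialScaling_smul (hef : IsPureBasis e f) (hg : g.gram e f = canonicalMatrix l d)
    (hr : ∀ i, SoulBodyRatioLtOne (d i)) :
    g.gram (fun i => binomialScaling (d i) • e i) f =
      canonicalMatrix l fun i => (SignType.sign (d i).body : Supernumber) := by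
  simp only [g.gram_smul_eq_canonicalMatrix hef hg fun i =>
    binomialScaling_mem_evenPart (diag_mem_evenPart hef.even hg i),
    binomialScaling_mul_self_mul (hr _)]

theorem exists_pos_smul_norm_diag_eq_one (hef : IsPureBasis e f)
    (hg : g.gram e f = canonicalMatrix l d) :
    ∃ c : Fin k → ℝ, (∀ i, 0 < c i) ∧
      IsPureBasis (fun i => algebraMap ℝ Supernumber (c i) • e i) f ∧
      ∃ d' : Fin k → Supernumber,
        g.gram (fun i => algebraMap ℝ Supernumber (c i) • e i) f = canonicalMatrix l d' ∧
        ∀ i, ‖d' i‖ = 1 ∧ (SoulBodyRatioLtOne (d i) ↔ ‖(d' i).soul‖ < 1 / 2) := by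
  have norm_pos : ∀ i, 0 < ‖d i‖ := fun i => norm_pos_iff.2 (diag_ne_zero hef hg i)
  have sqrt_pos : ∀ i, 0 < (√‖d i‖)⁻¹ := fun i => inv_pos.2 (Real.sqrt_pos.2 (norm_pos i))
  have norm_eq_one : ∀ i, ‖‖d i‖⁻¹ • d i‖ = 1 := fun i =>
    norm_smul_inv_norm (norm_pos_iff.1 (norm_pos i))
  have even : ∀ i, algebraMap ℝ Supernumber (√‖d i‖)⁻¹ ∈ EvenPart :=
    fun i => EvenPart.algebraMap_mem _
  refine ⟨fun i => (√‖d i‖)⁻¹, sqrt_pos,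
    hef.smul (fun i => (sqrt_pos i).ne'.isUnit.map (algebraMap ℝ Supernumber)) even,
    fun i => ‖d i‖⁻¹ • d i, ?_, fun i => ⟨norm_eq_one i, ?_⟩⟩
  · rw [g.gram_smul_eq_canonicalMatrix hef hg even]
    congr! 2 with i
    rw [← map_mul, ← mul_inv, Real.mul_self_sqrt (norm_nonneg _), ← Algebra.smul_def]
  · rw [← soulBodyRatioLtOne_smul (inv_ne_zero (norm_pos i).ne') (d i),
      soulBodyRatioLtOne_iff_of_norm_eq_one (norm_eq_one i)]

theorem isGInftyOn_diag {e : Fin k → ∀ q : M, SuperTangent m n q}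
    {f : Fin 2 × Fin l → ∀ q : M, SuperTangent m n q} {d : Fin k → M → Supernumber} (hU : IsOpen U)
    (he : ∀ i, IsSuperVectorField (e i) U)
    (hg : ∀ q ∈ U, g.gram (fun i => e i q) (fun α => f α q) = canonicalMatrix l fun i => d i q)
    (i : Fin k) : IsGInftyOn m n (d i) U :=
  (g.smooth U hU _ _ (he i) (he i)).congr hU fun q hq =>
    (toFun_eq_of_gram_eq_canonicalMatrix (hg q hq) i).symm

end CanonicalGram

end SuperRiemannianMetric

end Supermanifold

theorem mainTheorem4_general (m n l : ℕ) {M : Type*} [TopologicalSpace M]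
    [ChartedSpace (SuperSpace m n) M]
    (g : SuperRiemannianMetric m n M)
    (p : M) (U : Set M) (hU : IsOpen U) (hpU : p ∈ U)
    (e : Fin m → ∀ q : M, SuperTangent m n q) (f : Fin 2 × Fin l → ∀ q : M, SuperTangent m n q)
    (hef : IsPureFrameOn e f U)
    (d : Fin m → M → Supernumber)
    (hΓ : ∀ q ∈ U,
      g.gram (fun i => e i q) (fun α => f α q) = canonicalMatrix l (fun i => d i q)) :
    ((∀ i, SoulBodyRatioLtOne (d i p)) →
      ∃ V ⊆ U, IsOpen V ∧ p ∈ V ∧ ∃ lam : Fin m → M → Supernumber,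
        (∀ i, IsGInftyOn m n (lam i) V) ∧
        (∀ q ∈ V, ∀ i, lam i q ∈ Supernumber.EvenPart ∧ SoulBodyRatioLtOne (d i q) ∧
          IsBinomialScaling (d i q) (lam i q)) ∧
        IsPureFrameOn (fun i q => lam i q • e i q) f V ∧
        ∃ ε : Fin m → Supernumber, (∀ i, ε i = 1 ∨ ε i = -1) ∧
          ∀ q ∈ V, g.gram (fun i => lam i q • e i q) (fun α => f α q) = canonicalMatrix l ε) ∧
    (∃ c : Fin m → ℝ, (∀ i, 0 < c i) ∧
      ∃ e' : Fin m → SuperTangent m n p,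
        (∀ i, e' i = algebraMap ℝ Supernumber (c i) • e i p) ∧
        IsPureBasis e' (fun α => f α p) ∧
        ∃ d' : Fin m → Supernumber,
          g.gram e' (fun α => f α p) = canonicalMatrix l d' ∧
          ∀ i, ‖d' i‖ = 1 ∧ (SoulBodyRatioLtOne (d i p) ↔ ‖(d' i).soul‖ < 1 / 2)) ∧
    (∀ X : SuperTangent m n p, ‖g.toFun p X X‖ = 1 →
      (SoulBodyRatioLtOne (g.toFun p X X) ↔ ‖(g.toFun p X X).soul‖ < 1 / 2)) := by
  have diag_even : ∀ q ∈ U, ∀ i, d i q ∈ EvenPart := fun q hq =>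
    SuperRiemannianMetric.diag_mem_evenPart (hef.isPureBasis q hq).even (hΓ q hq)
  have diag_smooth : ∀ i, IsGInftyOn m n (d i) U :=
    SuperRiemannianMetric.isGInftyOn_diag hU hef.isSuperVectorField_even hΓ
  refine ⟨fun hr => ?_, ?_, fun X => soulBodyRatioLtOne_iff_of_norm_eq_one⟩
  · obtain ⟨V, hVU, hVo, hpV, ratio_lt_one, sign_eq⟩ :=
      exists_isOpen_soulBodyRatioLtOne_and_sign_body_eq hU hpU
        (fun i => (diag_smooth i).continuousAt hU hpU) hr
    have diag_smooth_V := fun i => (diag_smooth i).mono hVU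
    have diag_even_V := fun q hq => diag_even q (hVU hq)
    refine ⟨V, hVU, hVo, hpV, fun i q => binomialScaling (d i q),
      fun i => (diag_smooth_V i).binomialScaling hVo (ratio_lt_one · · i) (diag_even_V · · i),
      fun q hq i => ⟨binomialScaling_mem_evenPart (diag_even_V q hq i), ratio_lt_one q hq i,
        isBinomialScaling_binomialScaling (ratio_lt_one q hq i)⟩,
      (hef.mono hVU).binomialScaling_smul hVo diag_smooth_V ratio_lt_one diag_even_V,
      fun i => (SignType.sign (d i p).body : Supernumber), fun i => ?_, fun q hq => ?_⟩
    · rcases (hr i).1.lt_or_gt with h | h <;> simp [h]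
    · simp only [SuperRiemannianMetric.gram_binomialScaling_smul (hef.isPureBasis q (hVU hq))
        (hΓ q (hVU hq)) (ratio_lt_one q hq), sign_eq q hq]
  · obtain ⟨c, hc, hbasis, hgram⟩ :=
      SuperRiemannianMetric.exists_pos_smul_norm_diag_eq_one (hef.isPureBasis p hpU) (hΓ p hpU)
    exact ⟨c, hc, _, fun _ => rfl, hbasis, hgram⟩

theorem mainTheorem4 (m n l : ℕ) {M : Type*} [TopologicalSpace M]
    [ChartedSpace (SuperSpace m n) M] [HasGroupoid M (gInftyGroupoid m n)]
    (g : SuperRiemannianMetric m n M)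
    (p : M) (U : Set M) (hU : IsOpen U) (hpU : p ∈ U)
    (e : Fin m → ∀ q : M, SuperTangent m n q) (f : Fin 2 × Fin l → ∀ q : M, SuperTangent m n q)
    (hef : IsPureFrameOn e f U)
    (d : Fin m → M → Supernumber) (hd : ∀ q ∈ U, ∀ i, IsUnit (d i q))
    (hΓ : ∀ q ∈ U,
      g.gram (fun i => e i q) (fun α => f α q) = canonicalMatrix l (fun i => d i q)) :
    -- rescaling to a frame in which `η` has the diagonal entries `±1`
    ((∀ i, SoulBodyRatioLtOne (d i p)) →
      ∃ V ⊆ U, IsOpen V ∧ p ∈ V ∧ ∃ lam : Fin m → M → Supernumber,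
        (∀ i, IsGInftyOn m n (lam i) V) ∧
        (∀ q ∈ V, ∀ i, lam i q ∈ Supernumber.EvenPart ∧ SoulBodyRatioLtOne (d i q) ∧
          IsBinomialScaling (d i q) (lam i q)) ∧
        IsPureFrameOn (fun i q => lam i q • e i q) f V ∧
        ∃ ε : Fin m → Supernumber, (∀ i, ε i = 1 ∨ ε i = -1) ∧
          ∀ q ∈ V, g.gram (fun i => lam i q • e i q) (fun α => f α q) = canonicalMatrix l ε) ∧
    -- the basis can be normalized at `p` so that the diagonal entries have norm one
    (∃ c : Fin m → ℝ, (∀ i, 0 < c i) ∧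
      ∃ e' : Fin m → SuperTangent m n p,
        (∀ i, e' i = algebraMap ℝ Supernumber (c i) • e i p) ∧
        IsPureBasis e' (fun α => f α p) ∧
        ∃ d' : Fin m → Supernumber,
          g.gram e' (fun α => f α p) = canonicalMatrix l d' ∧
          ∀ i, ‖d' i‖ = 1 ∧ (SoulBodyRatioLtOne (d i p) ↔ ‖(d' i).soul‖ < 1 / 2)) ∧
    -- for every normalized basis the condition is that the souls have norm less than `1/2`
    (∀ (e' : Fin m → SuperTangent m n p) (f' : Fin 2 × Fin l → SuperTangent m n p),
      IsPureBasis e' f' → (∀ i, ‖g.toFun p (e' i) (e' i)‖ = 1) →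
        ∀ i, (SoulBodyRatioLtOne (g.toFun p (e' i) (e' i)) ↔
          ‖(g.toFun p (e' i) (e' i)).soul‖ < 1 / 2)) := by
  obtain ⟨rescale, normalize, iff_of_norm_eq_one⟩ :=
    mainTheorem4_general m n l g p U hU hpU e f hef d hΓ
  exact ⟨rescale, normalize, fun e' _ _ he' i => iff_of_norm_eq_one (e' i) (he' i)⟩
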